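/- Let $W$ be an index set with a countably incomplete ultrafilter $\mathcal U$ (that is, some countable intersection of members of $\mathcal U$ is not in $\mathcal U$; in particular $\mathcal U$ is non-principal and $W$ is infinite), and say that a property holds for almost all $w$ if it holds for all $w$ in some member of $\mathcal U$. Let $(R_w)_{w\in W}$ be commutative rings such that $R_w$ is a regular local ring for almost all $w$, and let $R$ be their ultraproduct, i.e. the quotient of $\prod_w R_w$ by the ideal of all sequences almost all of whose entries are zero. Then $R$ is a (not necessarily Noetherian) local ring. Suppose that its maximal ideal $\mathfrak m$ is finitely generated, i.e. that $R$ has finite embedding dimension. Then: 1. $R$ is cata-regular, i.e. its completion $\widehat R=\varprojlim_n R/\mathfrak m^n$ is a (Noetherian) regular local ring; 2. the canonical homomorphism $R/\bigcap_n\mathfrak m^n\to\widehat R$ is an isomorphism, i.e. the completion of $R$ is its separated quotient; 3. $\dim R_w=\dim\widehat R$ for almost all $w$. -/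

import Mathlib

namespace UltraRing

open Filter IsLocalRing

universe u v

/-- An ultrafilter is countably incomplete if it is not closed under countable intersections.
(Such an ultrafilter is automatically non-principal, and its index set is infinite.) -/
def CountablyIncomplete {W : Type u} (U : Ultrafilter W) : Prop :=
  ∃ s : ℕ → Set W, (∀ n, s n ∈ U) ∧ (⋂ n, s n) ∉ U

/-- The ideal of all sequences almost all of whose entries are zero. -/
def nullIdeal {W : Type u} (U : Ultrafilter W) (A : W → Type v) [∀ w, CommRing (A w)] :
    Ideal (∀ w, A w) where
  carrier := {a | ∀ᶠ w in (U : Filter W), a w = 0}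
  zero_mem' := Eventually.of_forall fun _ => rfl
  add_mem' := by
    intro a b ha hb
    filter_upwards [ha, hb] with w h₁ h₂
    simp [h₁, h₂]
  smul_mem' := by
    intro c a ha
    filter_upwards [ha] with w h
    simp [h]

/-- The ultraproduct of the rings `A w` with respect to the ultrafilter `U`. -/
abbrev Ultraproduct {W : Type u} (U : Ultrafilter W) (A : W → Type v) [∀ w, CommRing (A w)] :
    Type (max u v) :=
  (∀ w, A w) ⧸ nullIdeal U A

section Local

variable (R : Type u) [CommRing R] [IsLocalRing R]

/-- A local ring has finite embedding dimension if its maximal ideal can be generated by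
finitely many elements. -/
def HasFiniteEmbDim : Prop := (maximalIdeal R).FG

/-- The completion of a local ring with respect to its maximal ideal. -/
abbrev Completion : Type u := AdicCompletion (maximalIdeal R) R

/-- The ideal of infinitesimals, i.e. the intersection of the powers of the maximal ideal. -/
def infinitesimals : Ideal R := ⨅ n : ℕ, maximalIdeal R ^ n

/-- The separated quotient of a local ring. -/
abbrev SepQuotient : Type u := R ⧸ infinitesimals R

/-- The ring homomorphism from the separated quotient to the completion induced by the
canonical map of the ring to its completion. -/
noncomputable def sepToCompletion : SepQuotient R →+* Completion R :=
  Ideal.Quotient.lift (infinitesimals R) (algebraMap R (Completion R)) (by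
    intro a ha
    refine AdicCompletion.ext fun n => ?_
    have h : a ∈ maximalIdeal R ^ n := (Submodule.mem_iInf _).1 ha n
    have h' : a ∈ (maximalIdeal R ^ n • ⊤ : Ideal R) := by simpa using h
    exact Ideal.Quotient.eq_zero_iff_mem.2 h')

/-- A local ring (of finite embedding dimension) is cata-regular if its completion is a
regular local ring. -/
def IsCataRegular : Prop := IsRegularLocalRing (Completion R)

end Local

end UltraRing

/-! Write `m` for the maximal ideal of `R` and `S` for its separated quotient. Countable
incompleteness makes decreasing sequences of internal sets saturated
(`exists_forall_eventually_mem`). As `m` is finitely generated, its powers are internal, so Cauchy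
sequences in `R` converge (`exists_limit`) and `S` is the completion. Saturation also shows that the
closure of a finitely generated ideal only adds infinitesimals (`mem_sup_infinitesimals`). Hence
finitely generated ideals of `S` are closed, and `S` is Noetherian.

It remains to compare dimensions. Almost all `R_w` have one dimension `d`, and their `d` generators
assemble to generators of `m`, so `S` has embedding dimension at most `d`. Conversely, parameters of
`S` lift to `R`, generate an ideal containing a power of `m` by Nakayama, and descend to almost all
`R_w`; thus `d ≤ dim S`, and `S` is regular of dimension `d`. -/

/-! ### Commutative algebra: regularity and Noetherianity criteria -/

theorem Ideal.le_sup_pow_mul_of_le_sup_mul {S : Type*} [CommRing S] {F I : Ideal S} (P : Ideal S)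
    (h : P ≤ F ⊔ I * P) (n : ℕ) : P ≤ F ⊔ I ^ n * P := by
  induction n with
  | zero => simp
  | succ n ih =>
    have h1 : I ^ n * P ≤ I ^ n * F ⊔ I ^ (n + 1) * P := by
      rw [pow_succ, mul_assoc, ← Ideal.mul_sup]
      exact Ideal.mul_mono_right h
    have h2 : I ^ n * F ≤ F := Ideal.mul_le_right
    exact ih.trans (sup_le le_sup_left (h1.trans (sup_le (h2.trans le_sup_left) le_sup_right)))

theorem IsRegularLocalRing.of_spanFinrank_le_of_le_ringKrullDim {S : Type*} [CommRing S]
    [IsLocalRing S] [IsNoetherianRing S] {d : ℕ}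
    (hle : (IsLocalRing.maximalIdeal S).spanFinrank ≤ d) (hd : d ≤ ringKrullDim S) :
    IsRegularLocalRing S ∧ ringKrullDim S = d := by
  have hle' : ((IsLocalRing.maximalIdeal S).spanFinrank : WithBot ℕ∞) ≤ d := mod_cast hle
  exact ⟨.of_spanFinrank_maximalIdeal_le S (hle'.trans hd),
    le_antisymm ((ringKrullDim_le_spanFinrank_maximalIdeal S).trans hle') hd⟩

namespace IsLocalRing

/-- Cohen-type criterion: a local ring with finitely generated maximal ideal in which all finitely
generated ideals are closed in the adic topology is Noetherian. -/
theorem isNoetherianRing_of_fg_closed {S : Type*} [CommRing S] [IsLocalRing S]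
    (hm : (maximalIdeal S).FG)
    (hcl : ∀ J : Ideal S, J.FG → ∀ y, (∀ n : ℕ, y ∈ J ⊔ maximalIdeal S ^ n) → y ∈ J) :
    IsNoetherianRing S := by
  refine ⟨fun (I : Ideal S) => by_contra fun hI => ?_⟩
  obtain ⟨P, -, hP⟩ : ∃ P : Ideal S, I ≤ P ∧ Maximal (fun J : Ideal S => ¬ J.FG) P := by
    refine zorn_le_nonempty₀ {J : Ideal S | ¬ J.FG}
      (fun C hC hchain K hK => ⟨sSup C, ?_, fun _ => le_sSup⟩) I hI
    rintro ⟨G, hG⟩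
    obtain ⟨J, hJ, hGJ⟩ : ∃ J ∈ C, (G : Set S) ⊆ J := by
      refine hchain.directedOn.exists_mem_subset_of_finset_subset_biUnion ⟨K, hK⟩ fun x hx => ?_
      simp only [Set.mem_iUnion, SetLike.mem_coe, exists_prop]
      exact (Submodule.mem_sSup_of_directed ⟨K, hK⟩ hchain.directedOn).1
        (hG ▸ Submodule.subset_span hx)
    exact hC hJ ⟨G, le_antisymm (Submodule.span_le.2 hGJ) (hG ▸ le_sSup hJ)⟩
  have hprime : P.IsPrime := Ideal.isOka_fg.isPrime_of_maximal_not hP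
  have hPm : P ≤ maximalIdeal S := le_maximalIdeal hprime.ne_top
  obtain ⟨x, hxm, hxP⟩ : ∃ x ∈ maximalIdeal S, x ∉ P :=
    Set.not_subset.1 fun h => hP.prop (le_antisymm hPm h ▸ hm)
  have hfg : (P ⊔ Ideal.span {x}).FG :=
    not_not.1 (hP.not_prop_of_gt (Submodule.lt_sup_iff_notMem.2 hxP))
  obtain ⟨F, hFP, hF, hsup⟩ : ∃ F : Ideal S, F ≤ P ∧ F.FG ∧ P ≤ F ⊔ Ideal.span {x} := by
    obtain ⟨k, f, hf⟩ := Submodule.fg_iff_exists_fin_generating_family.1 hfg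
    have hmem : ∀ i, ∃ p ∈ P, ∃ r : S, p + r * x = f i := fun i => by
      have h : f i ∈ P ⊔ Ideal.span {x} := hf ▸ Submodule.subset_span ⟨i, rfl⟩
      obtain ⟨p, hp, q, hq, hpq⟩ := Submodule.mem_sup.1 h
      obtain ⟨r, rfl⟩ := Ideal.mem_span_singleton'.1 hq
      exact ⟨p, hp, r, hpq⟩
    choose p hp r hr using hmem
    refine ⟨Ideal.span (Set.range p), Ideal.span_le.2 (Set.range_subset_iff.2 hp),
      Submodule.fg_span (Set.finite_range p), le_sup_left.trans (hf ▸ Submodule.span_le.2 ?_)⟩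
    rintro _ ⟨i, rfl⟩
    rw [← hr i]
    exact add_mem (Ideal.mem_sup_left (Ideal.subset_span ⟨i, rfl⟩))
      (Ideal.mem_sup_right (Ideal.mul_mem_left _ _ (Ideal.mem_span_singleton_self x)))
  -- As `x ∉ P`, primality puts the coefficient of `x` in `P`. Nakayama is not available, since `P`
  -- is not finitely generated; closedness of `F` replaces it.
  have hle : ∀ n : ℕ, P ≤ F ⊔ maximalIdeal S ^ n * P := by
    have hstep : P ≤ F ⊔ maximalIdeal S * P := fun y hy => by
      obtain ⟨f, hf, q, hq, rfl⟩ := Submodule.mem_sup.1 (hsup hy)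
      obtain ⟨r, rfl⟩ := Ideal.mem_span_singleton'.1 hq
      have hr : r ∈ P :=
        (hprime.mem_or_mem ((P.add_mem_iff_right (hFP hf)).1 hy)).resolve_right hxP
      exact add_mem (Ideal.mem_sup_left hf)
        (Ideal.mem_sup_right (mul_comm r x ▸ Ideal.mul_mem_mul hxm hr))
    exact fun n => Ideal.le_sup_pow_mul_of_le_sup_mul P hstep n
  have hPF : P = F := by
    refine le_antisymm (fun y hy => hcl F hF y fun n => ?_) hFP
    have h : maximalIdeal S ^ n * P ≤ maximalIdeal S ^ n := Ideal.mul_le_left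
    exact (sup_le le_sup_left (h.trans le_sup_right) :
      F ⊔ maximalIdeal S ^ n * P ≤ F ⊔ maximalIdeal S ^ n) (hle n hy)
  exact hP.prop (hPF ▸ hF)

end IsLocalRing

/-- Finite sets of generators lift along surjective ring homomorphisms. -/
theorem Ideal.exists_finset_map_span_eq {R S : Type*} [CommRing R] [CommRing S] {f : R →+* S}
    (hf : Function.Surjective f) (s : Finset S) :
    ∃ t : Finset R, t.card ≤ s.card ∧ (Ideal.span (t : Set R)).map f = Ideal.span (s : Set S) := by
  classical
  refine ⟨s.image (Function.surjInv hf), Finset.card_image_le, ?_⟩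
  rw [Ideal.map_span, Finset.coe_image, ← Set.image_comp]
  simp [Function.surjInv_eq hf]

namespace UltraRing

open Filter IsLocalRing

/-! ### Saturation and Łoś-type transfer for ultraproducts -/

section Ultraproduct

variable {W : Type*} {U : Ultrafilter W} {A : W → Type*}

/-- Countable saturation: a decreasing sequence of internal sets that are almost everywhere
nonempty has a common point. -/
theorem CountablyIncomplete.exists_forall_eventually_mem (hU : CountablyIncomplete U)
    [∀ w, Nonempty (A w)] (D : ℕ → ∀ w, Set (A w)) (hD : ∀ w, Antitone fun n => D n w)
    (hne : ∀ n, ∀ᶠ w in (U : Filter W), (D n w).Nonempty) :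
    ∃ a : ∀ w, A w, ∀ n, ∀ᶠ w in (U : Filter W), a w ∈ D n w := by
  classical
  obtain ⟨s, hs, hs'⟩ := hU
  have key : ∀ w, ∃ b : A w, w ∉ ⋂ n, s n →
      ∀ n, (∀ k ≤ n, w ∈ s k) → (D n w).Nonempty → b ∈ D n w := by
    intro w
    by_cases hw : w ∈ ⋂ n, s n
    · exact ⟨Classical.arbitrary _, fun h => absurd hw h⟩
    obtain ⟨N, hN⟩ : ∃ N, w ∉ s N := by simpa using hw
    by_cases h0 : (D 0 w).Nonempty
    -- Since `w ∉ s N`, only levels below `N` impose a condition at `w`; a point of the deepest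
    -- nonempty level up to `N` meets them all.
    · let M := Nat.findGreatest (fun n => (D n w).Nonempty) N
      have hM : (D M w).Nonempty :=
        Nat.findGreatest_spec (P := fun n => (D n w).Nonempty) (Nat.zero_le N) h0
      refine ⟨hM.some, fun _ n hn hDn => hD w ?_ hM.some_mem⟩
      exact Nat.le_findGreatest (not_lt.1 fun h => hN (hn N h.le)) hDn
    · exact ⟨Classical.arbitrary _, fun _ n _ hDn =>
        absurd (hDn.mono (hD w (Nat.zero_le n))) h0⟩
  choose a ha using key
  refine ⟨a, fun n => ?_⟩
  have h1 : ∀ᶠ w in (U : Filter W), ∀ k ∈ Set.Iic n, w ∈ s k :=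
    (eventually_all_finite (Set.finite_Iic n)).2 fun k _ => hs k
  have h2 : ∀ᶠ w in (U : Filter W), w ∉ ⋂ n, s n := Ultrafilter.compl_mem_iff_notMem.2 hs'
  filter_upwards [h1, h2, hne n] with w hw1 hw2 hw3
  exact ha w hw2 n hw1 hw3

variable [∀ w, CommRing (A w)]

theorem mk_eq_zero_iff {a : ∀ w, A w} :
    Ideal.Quotient.mk (nullIdeal U A) a = 0 ↔ ∀ᶠ w in (U : Filter W), a w = 0 :=
  Ideal.Quotient.eq_zero_iff_mem

theorem mk_eq_mk_iff {a b : ∀ w, A w} :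
    Ideal.Quotient.mk (nullIdeal U A) a = Ideal.Quotient.mk (nullIdeal U A) b ↔
      ∀ᶠ w in (U : Filter W), a w = b w := by
  rw [← sub_eq_zero, ← map_sub, mk_eq_zero_iff]
  simp [sub_eq_zero]

theorem isUnit_mk_iff {a : ∀ w, A w} :
    IsUnit (Ideal.Quotient.mk (nullIdeal U A) a) ↔ ∀ᶠ w in (U : Filter W), IsUnit (a w) := by
  classical
  constructor
  · intro h
    obtain ⟨b, hb⟩ := isUnit_iff_exists_inv.1 h
    obtain ⟨b, rfl⟩ := Ideal.Quotient.mk_surjective b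
    rw [← map_mul, ← map_one (Ideal.Quotient.mk _), mk_eq_mk_iff] at hb
    filter_upwards [hb] with w hw
    exact IsUnit.of_mul_eq_one _ hw
  · intro h
    refine IsUnit.of_mul_eq_one (Ideal.Quotient.mk _ fun w => Ring.inverse (a w)) ?_
    rw [← map_mul, ← map_one (Ideal.Quotient.mk _), mk_eq_mk_iff]
    filter_upwards [h] with w hw
    exact Ring.mul_inverse_cancel _ hw

/-- An ultraproduct of local rings is local. -/
theorem isLocalRing_ultraproduct (h : ∀ᶠ w in (U : Filter W), IsLocalRing (A w)) :
    IsLocalRing (Ultraproduct U A) := by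
  have : Nontrivial (Ultraproduct U A) := by
    refine ⟨⟨Ideal.Quotient.mk _ 1, Ideal.Quotient.mk _ 0, fun h10 => ?_⟩⟩
    obtain ⟨w, hw, hl⟩ := ((mk_eq_mk_iff.1 h10).and h).exists
    exact one_ne_zero hw
  refine IsLocalRing.of_isUnit_or_isUnit_one_sub_self fun a => ?_
  obtain ⟨a, rfl⟩ := Ideal.Quotient.mk_surjective a
  rw [← map_one (Ideal.Quotient.mk _), ← map_sub, isUnit_mk_iff, isUnit_mk_iff,
    ← Ultrafilter.eventually_or]
  filter_upwards [h] with w hw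
  exact IsLocalRing.isUnit_or_isUnit_one_sub_self (a w)

/-- Łoś's theorem for membership in a finitely generated ideal. -/
theorem mk_mem_map_iff {I : Ideal (∀ w, A w)} (hI : I.FG) {a : ∀ w, A w} :
    Ideal.Quotient.mk (nullIdeal U A) a ∈ I.map (Ideal.Quotient.mk (nullIdeal U A)) ↔
      ∀ᶠ w in (U : Filter W), a w ∈ I.map (Pi.evalRingHom A w) := by
  constructor
  · intro h
    obtain ⟨b, hb, hab⟩ := (Ideal.mem_map_iff_of_surjective _ Ideal.Quotient.mk_surjective).1 h
    filter_upwards [mk_eq_mk_iff.1 hab] with w hw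
    exact hw ▸ Ideal.mem_map_of_mem (Pi.evalRingHom A w) hb
  · intro h
    obtain ⟨k, x, rfl⟩ := Submodule.fg_iff_exists_fin_generating_family.1 hI
    have key : ∀ w, ∃ c : Fin k → A w,
        a w ∈ (Ideal.span (Set.range x)).map (Pi.evalRingHom A w) → a w = ∑ i, c i * x i w := by
      intro w
      by_cases hw : a w ∈ (Ideal.span (Set.range x)).map (Pi.evalRingHom A w)
      · rw [Ideal.map_span, ← Set.range_comp] at hw
        obtain ⟨c, hc⟩ := Ideal.mem_span_range_iff_exists_fun.1 hw
        exact ⟨c, fun _ => hc.symm⟩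
      · exact ⟨0, fun h => absurd h hw⟩
    choose c hc using key
    have : Ideal.Quotient.mk (nullIdeal U A) a =
        Ideal.Quotient.mk (nullIdeal U A) (∑ i, (fun w => c w i) * x i) := by
      rw [mk_eq_mk_iff]
      filter_upwards [h] with w hw
      simpa using hc w hw
    rw [this]
    exact Ideal.mem_map_of_mem _ (sum_mem fun i _ =>
      Ideal.mul_mem_left _ _ (Ideal.subset_span ⟨i, rfl⟩))

theorem eventually_map_eval_le {I J : Ideal (∀ w, A w)} (hI : I.FG) (hJ : J.FG)
    (h : I.map (Ideal.Quotient.mk (nullIdeal U A)) ≤ J.map (Ideal.Quotient.mk (nullIdeal U A))) :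
    ∀ᶠ w in (U : Filter W), I.map (Pi.evalRingHom A w) ≤ J.map (Pi.evalRingHom A w) := by
  obtain ⟨s, rfl⟩ := hI
  have : ∀ᶠ w in (U : Filter W), ∀ x ∈ s, x w ∈ J.map (Pi.evalRingHom A w) :=
    (eventually_all_finset s).2 fun x hx =>
      (mk_mem_map_iff hJ).1 (h (Ideal.mem_map_of_mem _ (Ideal.subset_span hx)))
  filter_upwards [this] with w hw
  refine Ideal.map_le_iff_le_comap.2 (Ideal.span_le.2 fun x hx => hw x hx)

variable [IsLocalRing (Ultraproduct U A)]

theorem mk_mem_maximalIdeal_iff {a : ∀ w, A w} :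
    Ideal.Quotient.mk (nullIdeal U A) a ∈ maximalIdeal (Ultraproduct U A) ↔
      ∀ᶠ w in (U : Filter W), ¬ IsUnit (a w) := by
  rw [mem_maximalIdeal, mem_nonunits_iff, isUnit_mk_iff, Ultrafilter.eventually_not]

theorem maximalIdeal_eq_map_of_eventually {I : Ideal (∀ w, A w)} (hI : I.FG)
    (h : ∀ᶠ w in (U : Filter W), ∃ _ : IsLocalRing (A w),
      I.map (Pi.evalRingHom A w) = maximalIdeal (A w)) :
    I.map (Ideal.Quotient.mk (nullIdeal U A)) = maximalIdeal (Ultraproduct U A) := by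
  ext a
  obtain ⟨a, rfl⟩ := Ideal.Quotient.mk_surjective a
  rw [mk_mem_map_iff hI, mk_mem_maximalIdeal_iff]
  refine eventually_congr ?_
  filter_upwards [h] with w ⟨_, hw⟩
  rw [hw, mem_maximalIdeal, mem_nonunits_iff]

theorem eventually_map_eval_eq_maximalIdeal {I : Ideal (∀ w, A w)} (hI : I.FG)
    (hloc : ∀ᶠ w in (U : Filter W), IsLocalRing (A w))
    (h : I.map (Ideal.Quotient.mk (nullIdeal U A)) = maximalIdeal (Ultraproduct U A)) :
    ∀ᶠ w in (U : Filter W), ∃ _ : IsLocalRing (A w),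
      I.map (Pi.evalRingHom A w) = maximalIdeal (A w) := by
  -- Wherever the ideal differs from the set of nonunits, `b w` witnesses it, so one sequence tests
  -- equality in almost all components.
  have key : ∀ w, ∃ b : A w, (b ∈ I.map (Pi.evalRingHom A w) ↔ ¬ IsUnit b) →
      ∀ c : A w, c ∈ I.map (Pi.evalRingHom A w) ↔ ¬ IsUnit c := fun w => by
    by_contra! hcon
    obtain ⟨_, c, hc⟩ := hcon 0
    grind
  choose b hb using key
  have hbm : ∀ᶠ w in (U : Filter W), (b w ∈ I.map (Pi.evalRingHom A w) ↔ ¬ IsUnit (b w)) := by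
    have h' : Ideal.Quotient.mk (nullIdeal U A) b ∈ I.map (Ideal.Quotient.mk (nullIdeal U A)) ↔
      Ideal.Quotient.mk (nullIdeal U A) b ∈ maximalIdeal (Ultraproduct U A) := by rw [h]
    rw [mk_mem_map_iff hI, mk_mem_maximalIdeal_iff] at h'
    by_cases hc : ∀ᶠ w in (U : Filter W), ¬ IsUnit (b w)
    · filter_upwards [hc, h'.2 hc] with w h1 h2
      exact iff_of_true h2 h1
    · filter_upwards [Ultrafilter.eventually_not.2 hc, Ultrafilter.eventually_not.2 (mt h'.1 hc)]
        with w h1 h2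
      exact iff_of_false h2 h1
  filter_upwards [hloc, hbm] with w hw hbw
  exact ⟨hw, Ideal.ext fun c => by rw [hb w hbw c, mem_maximalIdeal, mem_nonunits_iff]⟩

/-- In an ultraproduct of finite embedding dimension, the closure of a finitely generated ideal is
obtained by adding the infinitesimals. -/
theorem mem_sup_infinitesimals (hU : CountablyIncomplete U)
    (hm : HasFiniteEmbDim (Ultraproduct U A)) {K : Ideal (Ultraproduct U A)} (hK : K.FG)
    {y : Ultraproduct U A} (hy : ∀ n : ℕ, y ∈ K ⊔ maximalIdeal (Ultraproduct U A) ^ n) :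
    y ∈ K ⊔ infinitesimals (Ultraproduct U A) := by
  obtain ⟨s, hs⟩ := hm
  obtain ⟨t, -, ht⟩ := Ideal.exists_finset_map_span_eq Ideal.Quotient.mk_surjective s
  obtain ⟨s', hs'⟩ := hK
  obtain ⟨t', -, ht'⟩ := Ideal.exists_finset_map_span_eq Ideal.Quotient.mk_surjective s'
  set I := Ideal.span (t : Set (∀ w, A w))
  set K₀ := Ideal.span (t' : Set (∀ w, A w))
  have hIfg : I.FG := ⟨t, rfl⟩
  have hKfg : K₀.FG := ⟨t', rfl⟩
  have hm : maximalIdeal (Ultraproduct U A) = I.map (Ideal.Quotient.mk _) := (ht.trans hs).symm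
  have hK : K = K₀.map (Ideal.Quotient.mk _) := (ht'.trans hs').symm
  obtain ⟨y, rfl⟩ := Ideal.Quotient.mk_surjective y
  -- The approximations of `y` from `K` are merged into a single `b` in `K` with `y - b`
  -- infinitesimal.
  obtain ⟨b, hb⟩ := hU.exists_forall_eventually_mem
    (fun n w => {b : A w | b ∈ K₀.map (Pi.evalRingHom A w) ∧
      y w - b ∈ (I ^ n).map (Pi.evalRingHom A w)})
    (fun w n n' h b hb => ⟨hb.1, Ideal.map_mono (Ideal.pow_le_pow_right h) hb.2⟩) (fun n => by
      obtain ⟨k, hk, z, hz, hkz⟩ := Submodule.mem_sup.1 (hy n)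
      obtain ⟨k, rfl⟩ := Ideal.Quotient.mk_surjective k
      obtain ⟨z, rfl⟩ := Ideal.Quotient.mk_surjective z
      rw [hK, mk_mem_map_iff hKfg] at hk
      rw [hm, ← Ideal.map_pow, mk_mem_map_iff hIfg.pow] at hz
      rw [← map_add, mk_eq_mk_iff] at hkz
      filter_upwards [hk, hz, hkz] with w h1 h2 h3
      exact ⟨k w, h1, by simpa [← h3] using h2⟩)
  rw [← sub_add_cancel y b, map_add, add_comm]
  refine add_mem (Ideal.mem_sup_left ?_) (Ideal.mem_sup_right ((Submodule.mem_iInf _).2 fun n => ?_))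
  · rw [hK, mk_mem_map_iff hKfg]
    exact (hb 0).mono fun w h => h.1
  · rw [hm, ← Ideal.map_pow, mk_mem_map_iff hIfg.pow]
    exact (hb n).mono fun w h => h.2

/-- Ultraproducts of finite embedding dimension are quasi-complete: Cauchy sequences converge. -/
theorem exists_limit (hU : CountablyIncomplete U)
    (hm : HasFiniteEmbDim (Ultraproduct U A)) (f : ℕ → Ultraproduct U A)
    (hf : ∀ n k, n ≤ k → f k - f n ∈ maximalIdeal (Ultraproduct U A) ^ n) :
    ∃ a, ∀ n, a - f n ∈ maximalIdeal (Ultraproduct U A) ^ n := by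
  obtain ⟨s, hs⟩ := hm
  obtain ⟨t, -, ht⟩ := Ideal.exists_finset_map_span_eq Ideal.Quotient.mk_surjective s
  set I := Ideal.span (t : Set (∀ w, A w))
  have hIfg : I.FG := ⟨t, rfl⟩
  have hm : maximalIdeal (Ultraproduct U A) = I.map (Ideal.Quotient.mk _) := (ht.trans hs).symm
  choose g hg using fun n => Ideal.Quotient.mk_surjective (f n)
  obtain ⟨b, hb⟩ := hU.exists_forall_eventually_mem
    -- Imposing all conditions up to `n` makes the sets decrease; `g n w` itself satisfies them
    -- almost everywhere.
    (fun n w => {b : A w | ∀ j ≤ n, b - g j w ∈ (I ^ j).map (Pi.evalRingHom A w)})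
    (fun w n n' h b hb j hj => hb j (hj.trans h)) (fun n => by
      have : ∀ᶠ w in (U : Filter W), ∀ j ∈ Set.Iic n,
          g n w - g j w ∈ (I ^ j).map (Pi.evalRingHom A w) :=
        (eventually_all_finite (Set.finite_Iic n)).2 fun j hj => by
          have h := hf j n hj
          rw [← hg, ← hg, ← map_sub, hm, ← Ideal.map_pow, mk_mem_map_iff hIfg.pow] at h
          exact h
      exact this.mono fun w hw => ⟨g n w, hw⟩)
  refine ⟨Ideal.Quotient.mk _ b, fun n => ?_⟩
  rw [← hg, ← map_sub, hm, ← Ideal.map_pow, mk_mem_map_iff hIfg.pow]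
  exact (hb n).mono fun w h => h n le_rfl

end Ultraproduct

/-! ### Separated quotient and completion of a local ring -/

section Local

variable {R : Type*} [CommRing R] [IsLocalRing R]

theorem infinitesimals_le_pow (n : ℕ) : infinitesimals R ≤ maximalIdeal R ^ n := iInf_le _ n

theorem infinitesimals_le_maximalIdeal : infinitesimals R ≤ maximalIdeal R := by
  simpa using infinitesimals_le_pow (R := R) 1

instance : IsLocalRing (SepQuotient R) :=
  have : Nontrivial (SepQuotient R) := Ideal.Quotient.nontrivial_iff.2 fun h =>
    (maximalIdeal.isMaximal R).ne_top (top_le_iff.1 (h ▸ infinitesimals_le_maximalIdeal))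
  IsLocalRing.of_surjective' (Ideal.Quotient.mk _) Ideal.Quotient.mk_surjective

theorem maximalIdeal_sepQuotient :
    maximalIdeal (SepQuotient R) = (maximalIdeal R).map (Ideal.Quotient.mk (infinitesimals R)) :=
  (eq_maximalIdeal (Ideal.IsMaximal.map_of_surjective_of_ker_le Ideal.Quotient.mk_surjective
    (by simpa using infinitesimals_le_maximalIdeal))).symm

theorem mk_mem_map_sepQuotient_iff {K : Ideal R} {a : R} :
    Ideal.Quotient.mk (infinitesimals R) a ∈ K.map (Ideal.Quotient.mk (infinitesimals R)) ↔
      a ∈ K ⊔ infinitesimals R := by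
  rw [← Ideal.mem_comap, Ideal.comap_map_of_surjective' _ Ideal.Quotient.mk_surjective,
    Ideal.mk_ker]

/-- Ideals of the quotient pull back to ideals containing the infinitesimals, so `hcl` says exactly
that finitely generated ideals there are closed. -/
theorem isNoetherianRing_sepQuotient (hm : HasFiniteEmbDim R)
    (hcl : ∀ K : Ideal R, K.FG → ∀ y, (∀ n : ℕ, y ∈ K ⊔ maximalIdeal R ^ n) →
      y ∈ K ⊔ infinitesimals R) :
    IsNoetherianRing (SepQuotient R) := by
  have hm' : (maximalIdeal (SepQuotient R)).FG := by
    rw [maximalIdeal_sepQuotient]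
    exact Ideal.FG.map hm _
  refine isNoetherianRing_of_fg_closed hm' fun J hJ y hy => ?_
  obtain ⟨K, hK, rfl⟩ : ∃ K : Ideal R, K.FG ∧ K.map (Ideal.Quotient.mk (infinitesimals R)) = J := by
    obtain ⟨s, hs⟩ := hJ
    obtain ⟨t, -, ht⟩ := Ideal.exists_finset_map_span_eq
      (Ideal.Quotient.mk_surjective (I := infinitesimals R)) s
    exact ⟨_, ⟨t, rfl⟩, ht.trans hs⟩
  obtain ⟨y, rfl⟩ := Ideal.Quotient.mk_surjective y
  refine mk_mem_map_sepQuotient_iff.2 (hcl K hK y fun n => ?_)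
  have heq : K.map (Ideal.Quotient.mk (infinitesimals R)) ⊔ maximalIdeal (SepQuotient R) ^ n =
      (K ⊔ maximalIdeal R ^ n).map (Ideal.Quotient.mk (infinitesimals R)) := by
    rw [Ideal.map_sup, Ideal.map_pow, maximalIdeal_sepQuotient]
  have hle : K ⊔ maximalIdeal R ^ n ⊔ infinitesimals R ≤ K ⊔ maximalIdeal R ^ n :=
    sup_le le_rfl ((infinitesimals_le_pow n).trans le_sup_right)
  exact hle (mk_mem_map_sepQuotient_iff.1 (heq.le (hy n)))

theorem sepToCompletion_bijective
    (hlim : ∀ f : ℕ → R, (∀ n k, n ≤ k → f k - f n ∈ maximalIdeal R ^ n) →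
      ∃ a, ∀ n, a - f n ∈ maximalIdeal R ^ n) :
    Function.Bijective (sepToCompletion R) := by
  constructor
  · refine (injective_iff_map_eq_zero _).2 fun a ha => ?_
    obtain ⟨a, rfl⟩ := Ideal.Quotient.mk_surjective a
    refine Ideal.Quotient.eq_zero_iff_mem.2 ((Submodule.mem_iInf _).2 fun n => ?_)
    have h : (sepToCompletion R (Ideal.Quotient.mk _ a)).val n = 0 := by rw [ha]; rfl
    have h' : a ∈ (maximalIdeal R ^ n • ⊤ : Ideal R) := Ideal.Quotient.eq_zero_iff_mem.1 h
    simpa using h'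
  · intro x
    obtain ⟨f, rfl⟩ := AdicCompletion.mk_surjective _ _ x
    obtain ⟨a, ha⟩ := hlim f fun n k hnk => by
      have h := (SModEq.sub_mem.1 (f.2 hnk).symm)
      simpa using h
    refine ⟨Ideal.Quotient.mk _ a, AdicCompletion.ext fun n => ?_⟩
    have h : a - f n ∈ (maximalIdeal R ^ n • ⊤ : Ideal R) := by simpa using ha n
    exact Ideal.Quotient.eq.2 h

theorem isCataRegular_of_bijective (hbij : Function.Bijective (sepToCompletion R))
    (hS : IsRegularLocalRing (SepQuotient R)) :
    IsCataRegular R ∧ ringKrullDim (SepQuotient R) = ringKrullDim (Completion R) :=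
  ⟨IsRegularLocalRing.of_ringEquiv (RingEquiv.ofBijective _ hbij),
    ringKrullDim_eq_of_ringEquiv (RingEquiv.ofBijective _ hbij)⟩

end Local

/-! ### Comparison of dimensions -/

/-- If the separated quotient of a local ring is Noetherian and the maximal ideal is finitely
generated, some ideal generated by `dim` many elements contains a power of the maximal ideal. -/
theorem exists_pow_maximalIdeal_le {R : Type*} [CommRing R] [IsLocalRing R]
    (hm : HasFiniteEmbDim R) [IsNoetherianRing (SepQuotient R)] :
    ∃ (s : Finset R) (N : ℕ), (s.card : WithBot ℕ∞) ≤ ringKrullDim (SepQuotient R) ∧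
      Ideal.span (s : Set R) ≤ maximalIdeal R ∧ maximalIdeal R ^ N ≤ Ideal.span (s : Set R) := by
  obtain ⟨s, hs, hcard⟩ :=
    (maximalIdeal (SepQuotient R)).exists_finset_card_eq_height_of_isNoetherianRing
  obtain ⟨t, htcard, ht⟩ := Ideal.exists_finset_map_span_eq
    (Ideal.Quotient.mk_surjective (I := infinitesimals R)) s
  -- The maximal ideal is minimal over `s`, hence the only prime containing it.
  have hrad : maximalIdeal (SepQuotient R) ≤ (Ideal.span (s : Set (SepQuotient R))).radical := by
    rw [Ideal.radical_eq_sInf]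
    refine le_sInf fun p hp => ?_
    exact hs.2 ⟨hp.2, hp.1⟩ (le_maximalIdeal hp.2.ne_top)
  obtain ⟨N, hN⟩ := Ideal.exists_pow_le_of_le_radical_of_fg hrad (IsNoetherian.noetherian _)
  refine ⟨t, N, ?_, ?_, ?_⟩
  · rw [← maximalIdeal_height_eq_ringKrullDim, ← hcard]
    exact_mod_cast htcard
  · intro x hx
    have h : Ideal.Quotient.mk (infinitesimals R) x ∈ maximalIdeal (SepQuotient R) :=
      hs.1.2 (ht ▸ Ideal.mem_map_of_mem _ hx)
    rw [maximalIdeal_sepQuotient, mk_mem_map_sepQuotient_iff,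
      sup_eq_left.2 infinitesimals_le_maximalIdeal] at h
    exact h
  -- Nakayama for `m ^ N`: infinitesimals lie in `m ^ (N + 1) = m * m ^ N`, so they can be absorbed.
  · refine Submodule.le_of_le_smul_of_le_jacobson_bot (I := maximalIdeal R) (Ideal.FG.pow hm)
      (maximalIdeal_le_jacobson _) fun x hx => ?_
    have h : Ideal.Quotient.mk (infinitesimals R) x ∈ Ideal.span (s : Set (SepQuotient R)) :=
      hN (by
        rw [maximalIdeal_sepQuotient, ← Ideal.map_pow]
        exact Ideal.mem_map_of_mem _ hx)
    rw [← ht, mk_mem_map_sepQuotient_iff] at h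
    rw [smul_eq_mul, ← pow_succ']
    exact (sup_le_sup_left (infinitesimals_le_pow (N + 1)) (Ideal.span (t : Set R))) h

theorem ringKrullDim_le_card_of_pow_maximalIdeal_le {R : Type*} [CommRing R] [IsLocalRing R]
    [IsNoetherianRing R] {s : Set R} (hs : s.Finite) {N : ℕ} (h : Ideal.span s ≤ maximalIdeal R)
    (hN : maximalIdeal R ^ N ≤ Ideal.span s) : ringKrullDim R ≤ s.ncard := by
  rw [← maximalIdeal_height_eq_ringKrullDim]
  have : maximalIdeal R ∈ (Ideal.span s).minimalPrimes :=
    ⟨⟨(maximalIdeal.isMaximal R).isPrime, h⟩, fun p hp _ => hp.1.le_of_pow_le (hN.trans hp.2)⟩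
  exact_mod_cast Ideal.height_le_card_of_mem_minimalPrimes_span hs this

section Regular

variable {W : Type*} {U : Ultrafilter W} {A : W → Type*} [∀ w, CommRing (A w)]
  [IsLocalRing (Ultraproduct U A)]

/-- The dimension of almost all components is at most the dimension of the separated quotient. -/
theorem eventually_ringKrullDim_le [IsNoetherianRing (SepQuotient (Ultraproduct U A))]
    (hloc : ∀ᶠ w in (U : Filter W), IsLocalRing (A w))
    (hnoeth : ∀ᶠ w in (U : Filter W), IsNoetherianRing (A w))
    (hm : HasFiniteEmbDim (Ultraproduct U A)) :
    ∀ᶠ w in (U : Filter W),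
      ringKrullDim (A w) ≤ ringKrullDim (SepQuotient (Ultraproduct U A)) := by
  obtain ⟨s, N, hcard, hs, hN⟩ := exists_pow_maximalIdeal_le hm
  obtain ⟨t, htcard, ht⟩ := Ideal.exists_finset_map_span_eq Ideal.Quotient.mk_surjective s
  obtain ⟨s', hs'⟩ := hm
  obtain ⟨t', -, ht'⟩ := Ideal.exists_finset_map_span_eq Ideal.Quotient.mk_surjective s'
  have hmax := ht'.trans hs'
  have htfg : (Ideal.span (t : Set (∀ w, A w))).FG := ⟨t, rfl⟩
  have ht'fg : (Ideal.span (t' : Set (∀ w, A w))).FG := ⟨t', rfl⟩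
  filter_upwards [hnoeth, eventually_map_eval_eq_maximalIdeal ht'fg hloc hmax,
    eventually_map_eval_le (U := U) htfg ht'fg (by rwa [hmax, ht]),
    eventually_map_eval_le (U := U) (ht'fg.pow (n := N)) htfg
      (by rwa [Ideal.map_pow, hmax, ht])] with w _ ⟨_, h1⟩ h2 h3
  rw [Ideal.map_pow, h1, Ideal.map_span] at h3
  rw [h1, Ideal.map_span] at h2
  refine (ringKrullDim_le_card_of_pow_maximalIdeal_le
    (t.finite_toSet.image _) h2 h3).trans (le_trans ?_ hcard)
  have := (Set.ncard_image_le (f := Pi.evalRingHom A w) t.finite_toSet).trans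
    ((Set.ncard_coe_finset t).trans_le htcard)
  exact_mod_cast this

/-- Almost all components of an ultraproduct of regular local rings of finite embedding dimension
have the same dimension. -/
theorem exists_eventually_ringKrullDim_eq
    (hreg : ∀ᶠ w in (U : Filter W), IsRegularLocalRing (A w))
    (hm : HasFiniteEmbDim (Ultraproduct U A)) :
    ∃ d : ℕ, ∀ᶠ w in (U : Filter W), ringKrullDim (A w) = d := by
  obtain ⟨s, hs⟩ := hm
  obtain ⟨t, -, ht⟩ := Ideal.exists_finset_map_span_eq Ideal.Quotient.mk_surjective s
  have hloc : ∀ᶠ w in (U : Filter W), IsLocalRing (A w) := hreg.mono fun w h => h.toIsLocalRing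
  -- The number of generators bounds the dimensions, and an ultrafilter selects one of finitely many
  -- values.
  have hle : ∀ᶠ w in (U : Filter W), ∃ d ∈ Set.Iic t.card, ringKrullDim (A w) = d := by
    filter_upwards [hreg, eventually_map_eval_eq_maximalIdeal ⟨t, rfl⟩ hloc (ht.trans hs)]
      with w hw ⟨_, h⟩
    refine ⟨(maximalIdeal (A w)).spanFinrank, ?_, hw.spanFinrank_maximalIdeal.symm⟩
    rw [← h, Ideal.map_span]
    exact (Submodule.spanFinrank_span_le_ncard_of_finite (t.finite_toSet.image _)).trans
      ((Set.ncard_image_le t.finite_toSet).trans (Set.ncard_coe_finset t).le)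
  obtain ⟨d, -, hd⟩ := (Ultrafilter.eventually_exists_mem_iff (Set.finite_Iic _)).1 hle
  exact ⟨d, hd⟩

/-- Regularity supplies exactly `d` generators in almost every component; indexing them by `Fin d`
turns them into `d` sequences. -/
theorem spanFinrank_maximalIdeal_sepQuotient_le {d : ℕ}
    (hreg : ∀ᶠ w in (U : Filter W), IsRegularLocalRing (A w))
    (hd : ∀ᶠ w in (U : Filter W), ringKrullDim (A w) = d) :
    (maximalIdeal (SepQuotient (Ultraproduct U A))).spanFinrank ≤ d := by
  have key : ∀ w, ∃ y : Fin d → A w, IsRegularLocalRing (A w) → ringKrullDim (A w) = d →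
      ∃ _ : IsLocalRing (A w), Ideal.span (Set.range y) = maximalIdeal (A w) := by
    intro w
    by_cases h : IsRegularLocalRing (A w) ∧ ringKrullDim (A w) = d
    · obtain ⟨h, h'⟩ := h
      have hcard : (maximalIdeal (A w)).spanFinrank = d := by
        exact_mod_cast h.spanFinrank_maximalIdeal.trans h'
      obtain ⟨s, hs, hspan⟩ := Submodule.FG.exists_span_finset_card_eq_spanFinrank
        (IsNoetherian.noetherian (maximalIdeal (A w)))
      let e := s.equivFinOfCardEq (hs.trans hcard)
      refine ⟨fun i => e.symm i, fun _ _ => ⟨h.toIsLocalRing, ?_⟩⟩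
      rw [← hspan]
      congr 1
      ext x
      refine ⟨?_, fun hx => ⟨e ⟨x, hx⟩, by simp⟩⟩
      rintro ⟨i, rfl⟩
      exact (e.symm i).2
    · exact ⟨0, fun h1 h2 => absurd ⟨h1, h2⟩ h⟩
  choose y hy using key
  let I : Ideal (∀ w, A w) := Ideal.span (Set.range fun i w => y w i)
  have hI : I.FG := Submodule.fg_span (Set.finite_range _)
  have hmax := maximalIdeal_eq_map_of_eventually (U := U) hI (by
    filter_upwards [hreg, hd] with w h1 h2
    obtain ⟨h, hw⟩ := hy w h1 h2
    refine ⟨h, ?_⟩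
    rw [← hw, Ideal.map_span, ← Set.range_comp]
    rfl)
  rw [maximalIdeal_sepQuotient, ← hmax]
  refine (Ideal.spanFinrank_map_le_of_fg _ (hI.map _)).trans
    ((Ideal.spanFinrank_map_le_of_fg _ hI).trans ?_)
  refine (Submodule.spanFinrank_span_le_ncard_of_finite (Set.finite_range _)).trans ?_
  rw [← Set.image_univ]
  exact (Set.ncard_image_le Set.finite_univ).trans (by simp [Set.ncard_univ])

end Regular

end UltraRing

theorem theoremT {W : Type*} (U : Ultrafilter W) (hU : UltraRing.CountablyIncomplete U)
    (A : W → Type*) [∀ w, CommRing (A w)]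
    (hreg : ∀ᶠ w in (U : Filter W), IsRegularLocalRing (A w)) :
    ∃ _ : IsLocalRing (UltraRing.Ultraproduct U A),
      UltraRing.HasFiniteEmbDim (UltraRing.Ultraproduct U A) →
        UltraRing.IsCataRegular (UltraRing.Ultraproduct U A) ∧
        Function.Bijective (UltraRing.sepToCompletion (UltraRing.Ultraproduct U A)) ∧
        ∀ᶠ w in (U : Filter W),
          ringKrullDim (A w) =
            ringKrullDim (UltraRing.Completion (UltraRing.Ultraproduct U A)) := by
  have hloc : ∀ᶠ w in (U : Filter W), IsLocalRing (A w) := hreg.mono fun w h => h.toIsLocalRing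
  have hnoeth : ∀ᶠ w in (U : Filter W), IsNoetherianRing (A w) :=
    hreg.mono fun w h => inferInstance
  have hR := UltraRing.isLocalRing_ultraproduct hloc
  refine ⟨hR, fun hm => ?_⟩
  have hbij := UltraRing.sepToCompletion_bijective (R := UltraRing.Ultraproduct U A)
    fun f hf => UltraRing.exists_limit hU hm f hf
  have hN := UltraRing.isNoetherianRing_sepQuotient hm
    fun K hK y hy => UltraRing.mem_sup_infinitesimals hU hm hK hy
  obtain ⟨d, hd⟩ := UltraRing.exists_eventually_ringKrullDim_eq hreg hm
  obtain ⟨w, hw, hdim⟩ := (hd.and (UltraRing.eventually_ringKrullDim_le hloc hnoeth hm)).exists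
  have hspan := UltraRing.spanFinrank_maximalIdeal_sepQuotient_le hreg hd
  obtain ⟨hS, hdS⟩ := IsRegularLocalRing.of_spanFinrank_le_of_le_ringKrullDim hspan (hw ▸ hdim)
  obtain ⟨hcata, hdimC⟩ := UltraRing.isCataRegular_of_bijective hbij hS
  exact ⟨hcata, hbij, hd.mono fun w h => h.trans (hdS.symm.trans hdimC)⟩
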